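/- Let $\mathbb X$ be a locally compact separable metric space and let $\sigma$ be a $\sigma$-finite non-atomic Borel measure on $\mathbb X$. Let $\Omega$ be the space of configurations (locally finite subsets) $\omega\subset\mathbb X$. A configuration $\omega$ is identified with the measure $\sum_{y\in\omega}\delta_y$, and $\Omega$ carries the smallest $\sigma$-algebra making $\omega\mapsto\omega(A)$ measurable for every Borel set $A\subset\mathbb X$. Let $\mathbb P$, with expectation $\mathbb E$, be the Poisson probability measure on $\Omega$ with intensity $\sigma$: under $\mathbb P$ the variable $\omega(A)$ is Poisson with parameter $\sigma(A)$ for every Borel $A$ (and $\omega(A)=\infty$ a.s. if $\sigma(A)=\infty$), and $\omega(A_1),\dots,\omega(A_n)$ are independent for pairwise disjoint Borel $A_1,\dots,A_n$. Write $\mathbb X^k_{\neq}=\{(x_1,\dots,x_k)\in\mathbb X^k: x_i\neq x_j\text{ for }i\neq j\}$. Let $f\ge 0$ be a $2$-process, that is, a jointly measurable map $\mathbb X^2\times\Omega\ni(x_1,x_2;\omega)\mapsto f(x_1,x_2;\omega)\in[0,\infty)$. Then, as an identity in $[0,\infty]$, \begin{align*} &\mathbb{E} \left(\int_{\mathbb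 X^2}f(x_1,x_2;\omega)\,\omega(dx_1)\,\omega(dx_2)\right)^2= \int_{\mathbb X}\mathbb{E} f^2(x,x;\omega \cup \{x\})\, \sigma(dx)\\ &+2\int_{\mathbb X_{\neq}^2} \mathbb{E} f(x,x;\omega\cup \{x,y\})f(x,y;\omega\cup \{x,y\})\, \sigma(dx)\sigma(dy)\\ &+2\int_{\mathbb X_{\neq}^2} \mathbb{E} f(x,x;\omega\cup \{x,y\})f(y,x;\omega\cup \{x,y\})\, \sigma(dx)\sigma(dy)\\ &+\int_{\mathbb X_{\neq}^2} \mathbb{E} f(x,x;\omega\cup \{x,y\})f(y,y;\omega\cup \{x,y\})\,\sigma(dx)\sigma(dy)\\ &+\int_{\mathbb X_{\neq}^2} \mathbb{E} f^2(x,y;\omega\cup \{x,y\})\,\sigma(dx)\sigma(dy)\\ &+\int_{\mathbb X_{\neq}^2} \mathbb{E} f(x,y;\omega\cup \{x,y\})f(y,x;\omega\cup \{x,y\})\,\sigma(dx)\sigma(dy)\\ &+2\int_{\mathbb X_{\neq}^3} \mathbb{E} f(x,x;\omega\cup \{x,y,z\})f(y,z;\omega\cup \{x,y,z\})\, \sigma(dx)\sigma(dy)\sigma(dz)\\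 &+2\int_{\mathbb X_{\neq}^3} \mathbb{E} f(x,y;\omega\cup \{x,y,z\})f(z,x;\omega\cup \{x,y,z\})\, \sigma(dx)\sigma(dy)\sigma(dz)\\ &+\int_{\mathbb X_{\neq}^3} \mathbb{E} f(x,y;\omega\cup \{x,y,z\})f(x,z;\omega\cup \{x,y,z\})\, \sigma(dx)\sigma(dy)\sigma(dz)\\ &+\int_{\mathbb X_{\neq}^3} \mathbb{E} f(y,x;\omega\cup \{x,y,z\})f(z,x;\omega\cup \{x,y,z\})\, \sigma(dx)\sigma(dy)\sigma(dz)\\ &+\int_{\mathbb X_{\neq}^4} \mathbb{E} f(x,y;\omega\cup \{x,y,z,t\})f(z,t;\omega\cup \{x,y,z,t\})\, \sigma(dx)\sigma(dy)\sigma(dz)\sigma(dt). \end{align*} -/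

import Mathlib

open MeasureTheory ProbabilityTheory Topology
open scoped NNReal ENNReal

/-- A configuration on `X`: a locally finite subset of `X`. -/
@[ext] structure Configuration (X : Type*) [TopologicalSpace X] where
  /-- The underlying set of points. -/
  carrier : Set X
  /-- Every point of the space has a neighbourhood containing only finitely many points. -/
  locallyFinite : ∀ x : X, ∃ U ∈ 𝓝 x, (U ∩ carrier).Finite

namespace Configuration

/-- The configuration seen as a measure: the sum of the Dirac measures at its points. -/
noncomputable def toMeasure {X : Type*} [TopologicalSpace X] [MeasurableSpace X]
    (ω : Configuration X) : Measure X :=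
  Measure.sum fun y : ω.carrier => Measure.dirac (y : X)

/-- The smallest σ-algebra on configurations making `ω ↦ ω(A)` measurable for every
measurable set `A`. -/
noncomputable instance instMeasurableSpace {X : Type*} [TopologicalSpace X] [MeasurableSpace X] :
    MeasurableSpace (Configuration X) :=
  ⨆ (A : Set X) (_ : MeasurableSet A),
    MeasurableSpace.comap (fun ω : Configuration X => ω.toMeasure A) inferInstance

/-- The configuration `ω ∪ {y₁, …, y_k}`. -/
def addPoints {X : Type*} [TopologicalSpace X] {k : ℕ} (ω : Configuration X) (y : Fin k → X) :
    Configuration X where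
  carrier := ω.carrier ∪ Set.range y
  locallyFinite := by
    intro x
    obtain ⟨U, hU, hfin⟩ := ω.locallyFinite x
    refine ⟨U, hU, ?_⟩
    rw [Set.inter_union_distrib_left]
    exact hfin.union ((Set.finite_range y).subset Set.inter_subset_right)

end Configuration

/-- `P` is the Poisson probability measure with intensity `σ` on the configuration space: under
`P`, the number of points `ω(A)` in a Borel set `A` has the Poisson distribution with parameter
`σ(A)` (meaning `ω(A) = ∞` almost surely if `σ(A) = ∞`), and the numbers of points in finitely
many pairwise disjoint Borel sets are independent. -/
structure IsPoissonMeasure {X : Type*} [TopologicalSpace X] [MeasurableSpace X]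
    (P : Measure (Configuration X)) (σ : Measure X) : Prop where
  isProbabilityMeasure : IsProbabilityMeasure P
  map_eq_poisson : ∀ (A : Set X) (r : ℝ≥0), MeasurableSet A → σ A = (r : ℝ≥0∞) →
    P.map (fun ω => ω.toMeasure A) = (poissonMeasure r).map (fun n : ℕ => (n : ℝ≥0∞))
  ae_eq_top : ∀ A : Set X, MeasurableSet A → σ A = ∞ → ∀ᵐ ω ∂P, ω.toMeasure A = ∞
  iIndepFun : ∀ (n : ℕ) (A : Fin n → Set X), (∀ i, MeasurableSet (A i)) →
    Pairwise (fun i j => Disjoint (A i) (A j)) →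
    ProbabilityTheory.iIndepFun (fun (i : Fin n) (ω : Configuration X) => ω.toMeasure (A i)) P

/-- A `k`-process: a real function of `k` points and a configuration that is jointly measurable. -/
def IsProcess {X : Type*} [TopologicalSpace X] [MeasurableSpace X] {k : ℕ}
    (f : (Fin k → X) → Configuration X → ℝ) : Prop :=
  Measurable fun p : (Fin k → X) × Configuration X => f p.1 p.2

/-- The set of `k`-tuples of pairwise different points. -/
def distinctTuples (X : Type*) (k : ℕ) : Set (Fin k → X) :=
  {x | ∀ i j, i ≠ j → x i ≠ x j}

/-!
Expanding the square turns the left-hand side into a sum over quadruples of points of `ω`. Splitting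
it according to which of the four points coincide gives fifteen sums over tuples of pairwise
different points (`Configuration.sq_lintegral_lintegral_toMeasure`, obtained by iterating
`Configuration.factorialSum_lintegral`); up to relabelling the points, these are the terms on the
right-hand side with their multiplicities. The expectation of each is computed by the multivariate
Mecke formula `IsPoissonMeasure.lintegral_factorialSum`: the expected sum of `g ω x` over tuples `x`
of pairwise different points of `ω` is the `σ`-integral over `x` of the expectation of
`g (ω ∪ {x₁, …, x_k}) x`.

The multivariate formula follows by induction from the univariate one,
`IsPoissonMeasure.lintegral_lintegral_toMeasure`, since a fixed point `y` almost surely does not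
belong to `ω`, and then the tuples in `ω ∪ {y}` avoiding `y` are the tuples in `ω`. The univariate
formula is an equality of two measures on configurations times points
(`IsPoissonMeasure.compProd_toKernel_eq_map`), which is checked on a generating π-system: products
`F × B` where `σ B < ∞` and `F` depends only on the numbers of points in the cells of a finite
partition. After refining the partition, `B` is a union of cells, and the claim for a single cell
reduces, by independence, to the identity `E[N g(N)] = r E[g(N + 1)]` for a Poisson variable `N` of
parameter `r`.
-/

/-! ### Configurations as measures -/

namespace Configuration

lemma finite_inter_of_isCompact {X : Type*} [TopologicalSpace X] (ω : Configuration X)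
    {K : Set X} (hK : IsCompact K) :
    (K ∩ ω.carrier).Finite := by
  refine hK.induction_on (p := fun s => (s ∩ ω.carrier).Finite) (by simp)
    (fun s t hst ht => ht.subset (Set.inter_subset_inter_left _ hst))
    (fun s t hs ht => by rw [Set.union_inter_distrib_right]; exact hs.union ht) fun x _ => ?_
  obtain ⟨U, hU, hfin⟩ := ω.locallyFinite x
  exact ⟨U, mem_nhdsWithin_of_mem_nhds hU, hfin⟩

lemma addPoints_singleton_of_mem {X : Type*} [TopologicalSpace X] (ω : Configuration X) {x : X}
    (hx : x ∈ ω.carrier) :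
    ω.addPoints ![x] = ω := by
  ext y
  simp only [addPoints, Matrix.range_cons, Matrix.range_empty, Set.union_empty]
  grind

lemma addPoints_cons {X : Type*} [TopologicalSpace X] {k : ℕ} (ω : Configuration X) (x : X)
    (y : Fin k → X) :
    ω.addPoints (Fin.cons x y : Fin (k + 1) → X) = (ω.addPoints y).addPoints ![x] := by
  ext z
  simp only [addPoints, Matrix.range_cons, Matrix.range_empty, Set.union_empty, Fin.range_cons,
    Set.mem_union, Set.mem_insert_iff, Set.mem_singleton_iff]
  tauto

lemma addPoints_zero {X : Type*} [TopologicalSpace X] (ω : Configuration X) (y : Fin 0 → X) :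
    ω.addPoints y = ω := by
  ext z
  simp [addPoints]

/-- A disjoint measurable cover of the space by relatively compact sets. -/
def shell (X : Type*) [TopologicalSpace X] [SigmaCompactSpace X] : ℕ → Set X :=
  disjointed (compactCovering X)

lemma measurableSet_shell {X : Type*} [TopologicalSpace X] [T2Space X] [SigmaCompactSpace X]
    [MeasurableSpace X] [BorelSpace X] (m : ℕ) :
    MeasurableSet (shell X m) :=
  .disjointed (fun n => (isCompact_compactCovering X n).measurableSet) m

lemma iUnion_shell {X : Type*} [TopologicalSpace X] [SigmaCompactSpace X] :
    ⋃ m, shell X m = Set.univ := by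
  rw [shell, iUnion_disjointed, iUnion_compactCovering]

section Basic

variable {X : Type*} [TopologicalSpace X] [MeasurableSpace X]

lemma lintegral_toMeasure [MeasurableSingletonClass X] (ω : Configuration X) (g : X → ℝ≥0∞) :
    ∫⁻ x, g x ∂ω.toMeasure = ∑' x : ω.carrier, g x := by
  simp [toMeasure, lintegral_sum_measure]

lemma toMeasure_apply [MeasurableSingletonClass X] (ω : Configuration X) {A : Set X}
    (hA : MeasurableSet A) : ω.toMeasure A = ((A ∩ ω.carrier).encard : ℝ≥0∞) := by
  rw [← lintegral_indicator_one hA, lintegral_toMeasure, ← ENNReal.tsum_set_one,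
    tsum_subtype ω.carrier (A.indicator 1), tsum_subtype (A ∩ ω.carrier) (fun _ => (1 : ℝ≥0∞)),
    Set.inter_comm, ← Set.indicator_indicator]
  rfl

lemma toMeasure_singleton_eq_zero [MeasurableSingletonClass X] {ω : Configuration X} {x : X} :
    ω.toMeasure {x} = 0 ↔ x ∉ ω.carrier := by
  rw [toMeasure_apply ω (measurableSet_singleton x)]
  simp

lemma measurable_toMeasure_apply {A : Set X} (hA : MeasurableSet A) :
    Measurable fun ω : Configuration X => ω.toMeasure A :=
  Measurable.of_comap_le (le_iSup₂_of_le A hA le_rfl)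

lemma measurable_toMeasure : Measurable (toMeasure : Configuration X → Measure X) :=
  Measure.measurable_of_measurable_coe _ fun _ hA => measurable_toMeasure_apply hA

lemma measurable_of_toMeasure_apply {α : Type*} [MeasurableSpace α] {F : α → Configuration X}
    (h : ∀ A, MeasurableSet A → Measurable fun a => (F a).toMeasure A) : Measurable F := by
  rw [measurable_iff_comap_le]
  simp only [instMeasurableSpace, MeasurableSpace.comap_iSup, MeasurableSpace.comap_comp]
  exact iSup₂_le fun A hA => (h A hA).comap_le

lemma toMeasure_addPoints_singleton [MeasurableSingletonClass X] (ω : Configuration X) {x : X}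
    (hx : x ∉ ω.carrier) {A : Set X} (hA : MeasurableSet A) :
    (ω.addPoints ![x]).toMeasure A = ω.toMeasure A + A.indicator 1 x := by
  rw [toMeasure_apply _ hA, toMeasure_apply _ hA]
  simp only [addPoints, Matrix.range_cons, Matrix.range_empty, Set.union_empty]
  rw [Set.inter_union_distrib_left, Set.encard_union_eq]
  · by_cases h : x ∈ A <;> simp [h]
  · exact Set.disjoint_left.2 fun y hy hy' => hx (hy'.2 ▸ hy.2)

/-- The configuration, seen as a random measure, as a kernel from configurations to points. -/
noncomputable def toKernel (X : Type*) [TopologicalSpace X] [MeasurableSpace X] :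
    Kernel (Configuration X) X where
  toFun := toMeasure
  measurable' := measurable_toMeasure

@[simp] lemma toKernel_apply (ω : Configuration X) : toKernel X ω = ω.toMeasure := rfl

end Basic

section Kernel

variable {X : Type*} [TopologicalSpace X] [T2Space X] [SecondCountableTopology X]
  [SigmaCompactSpace X] [MeasurableSpace X] [BorelSpace X]

lemma exists_toMeasure_shell_eq_natCast (ω : Configuration X) (m : ℕ) :
    ∃ n : ℕ, ω.toMeasure (shell X m) = n := by
  have hfin : (shell X m ∩ ω.carrier).Finite :=
    (ω.finite_inter_of_isCompact (isCompact_compactCovering X m)).subset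
      (Set.inter_subset_inter_left _ (disjointed_subset _ m))
  refine ⟨(shell X m ∩ ω.carrier).ncard, ?_⟩
  rw [toMeasure_apply ω (measurableSet_shell m), ← hfin.cast_ncard_eq]
  simp

open Classical in
/-- The kernel is uniformly bounded on each shell once the number of points there is fixed, so it
is a countable sum of finite kernels. -/
instance isSFiniteKernel_toKernel : IsSFiniteKernel (toKernel X) := by
  have hmeas (m n : ℕ) : MeasurableSet {ω : Configuration X | ω.toMeasure (shell X m) = n} :=
    measurable_toMeasure_apply (measurableSet_shell m) (measurableSet_singleton _)
  let κ (p : ℕ × ℕ) : Kernel (Configuration X) X :=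
    Kernel.piecewise (hmeas p.1 p.2) ((toKernel X).restrict (measurableSet_shell p.1)) 0
  have hκ (p : ℕ × ℕ) : IsFiniteKernel (κ p) := by
    refine ⟨⟨p.2, by simp, fun ω => ?_⟩⟩
    by_cases h : ω.toMeasure (shell X p.1) = p.2
    · simp [κ, Kernel.piecewise_apply, h, Kernel.restrict_apply]
    · simp [κ, Kernel.piecewise_apply, h]
  have hsum : toKernel X = Kernel.sum κ := by
    ext ω A hA
    rw [Kernel.sum_apply' _ _ hA, ENNReal.tsum_prod (f := fun m n => κ (m, n) ω A)]
    have hm (m : ℕ) : ∑' n : ℕ, κ (m, n) ω A = ω.toMeasure (A ∩ shell X m) := by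
      obtain ⟨n, hn⟩ := exists_toMeasure_shell_eq_natCast ω m
      rw [tsum_eq_single n]
      · simp [κ, Kernel.piecewise_apply, hn, Kernel.restrict_apply, Measure.restrict_apply hA]
      · intro k hk
        simp [κ, Kernel.piecewise_apply, hn, hk.symm]
    simp_rw [hm]
    rw [toKernel_apply, ← measure_iUnion, ← Set.inter_iUnion, iUnion_shell, Set.inter_univ]
    · exact fun i j hij => ((disjoint_disjointed _ hij).mono Set.inter_subset_right
        Set.inter_subset_right)
    · exact fun m => hA.inter (measurableSet_shell m)
  rw [hsum]
  exact Kernel.isSFiniteKernel_sum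

lemma measurable_toMeasure_singleton :
    Measurable fun p : Configuration X × X => p.1.toMeasure {p.2} := by
  have h : Measurable fun p : Configuration X × X =>
      Kernel.prodMkRight X (toKernel X) p (Prod.mk p ⁻¹' {q | q.1.2 = q.2}) :=
    Kernel.measurable_kernel_prodMk_left
      (measurableSet_eq_fun (measurable_snd.comp measurable_fst) measurable_snd)
  convert h using 2 with p
  congr 1
  ext y
  simp [eq_comm]

lemma measurableSet_mem_carrier :
    MeasurableSet {p : Configuration X × X | p.2 ∈ p.1.carrier} := by
  have h := (measurable_toMeasure_singleton (X := X)) (measurableSet_singleton 0)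
  convert h.compl using 1
  ext p
  simp [toMeasure_singleton_eq_zero]

lemma measurable_addPoints_singleton :
    Measurable fun p : Configuration X × X => p.1.addPoints ![p.2] := by
  classical
  refine measurable_of_toMeasure_apply fun A hA => ?_
  have h : (fun p : Configuration X × X => (p.1.addPoints ![p.2]).toMeasure A) =
      {p : Configuration X × X | p.2 ∈ p.1.carrier}.piecewise (fun p => p.1.toMeasure A)
        (fun p => p.1.toMeasure A + A.indicator 1 p.2) := by
    ext p
    by_cases hp : p.2 ∈ p.1.carrier
    · simp [Set.piecewise, hp, addPoints_singleton_of_mem]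
    · simp [Set.piecewise, hp, toMeasure_addPoints_singleton _ hp hA]
  rw [h]
  have h1 : Measurable fun p : Configuration X × X => p.1.toMeasure A :=
    (measurable_toMeasure_apply hA).comp measurable_fst
  exact h1.piecewise measurableSet_mem_carrier
    (h1.add ((measurable_one.indicator hA).comp measurable_snd))

lemma measurable_addPoints (k : ℕ) :
    Measurable fun p : Configuration X × (Fin k → X) => p.1.addPoints p.2 := by
  induction k with
  | zero => simpa only [addPoints_zero] using measurable_fst
  | succ k ih =>
    have h (p : Configuration X × (Fin (k + 1) → X)) :
        p.1.addPoints p.2 = (p.1.addPoints (Fin.tail p.2)).addPoints ![p.2 0] := by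
      rw [← addPoints_cons, Fin.cons_self_tail]
    simp_rw [h]
    have ht : Measurable fun p : Configuration X × (Fin (k + 1) → X) => (p.1, Fin.tail p.2) :=
      measurable_fst.prodMk (measurable_pi_lambda _ fun i =>
        (measurable_pi_apply i.succ).comp measurable_snd)
    exact measurable_addPoints_singleton.comp
      ((ih.comp ht).prodMk ((measurable_pi_apply 0).comp measurable_snd))

end Kernel

end Configuration

/-! ### Size-biasing Poisson vectors, and finite partitions of the space -/

lemma lintegral_natCast_mul_poissonMeasure (r : ℝ≥0) (g : ℕ → ℝ≥0∞) :
    ∫⁻ n, n * g n ∂(poissonMeasure r) = r * ∫⁻ n, g (n + 1) ∂(poissonMeasure r) := by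
  simp only [poissonMeasure, lintegral_sum_measure, lintegral_smul_measure, lintegral_dirac,
    smul_eq_mul]
  rw [tsum_eq_zero_add' ENNReal.summable, ← ENNReal.tsum_mul_left]
  simp only [Nat.cast_zero, zero_mul, mul_zero, zero_add]
  refine tsum_congr fun n => ?_
  have h : ENNReal.ofReal (Real.exp (-r) * r ^ (n + 1) / (n + 1).factorial) * ((n + 1 : ℕ) : ℝ≥0∞)
      = r * ENNReal.ofReal (Real.exp (-r) * r ^ n / n.factorial) := by
    rw [← ENNReal.ofReal_natCast, ← ENNReal.ofReal_coe_nnreal, ← ENNReal.ofReal_mul (by positivity),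
      ← ENNReal.ofReal_mul (by positivity)]
    congr 1
    rw [Nat.factorial_succ]
    push_cast
    field_simp
    ring
  rw [← mul_assoc, h, mul_assoc]

/-- The Chen–Stein identity `E[N g(N)] = r E[g(N + 1)]` for a Poisson variable `N`. -/
lemma lintegral_mul_comp_of_map_eq_poisson {Ω : Type*} [MeasurableSpace Ω] {P : Measure Ω}
    {N : Ω → ℝ≥0∞} (hN : Measurable N) {r : ℝ≥0}
    (h : P.map N = (poissonMeasure r).map (fun n : ℕ => (n : ℝ≥0∞))) {g : ℝ≥0∞ → ℝ≥0∞}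
    (hg : Measurable g) :
    ∫⁻ ω, N ω * g (N ω) ∂P = r * ∫⁻ ω, g (N ω + 1) ∂P := by
  have hc : Measurable (fun n : ℕ => (n : ℝ≥0∞)) := measurable_from_nat
  rw [← lintegral_map (f := fun t => t * g t) (measurable_id.mul hg) hN,
    ← lintegral_map (f := fun t => g (t + 1)) (hg.comp (measurable_id.add_const 1)) hN, h,
    lintegral_map (f := fun t => t * g t) (measurable_id.mul hg) hc,
    lintegral_map (f := fun t => g (t + 1)) (hg.comp (measurable_id.add_const 1)) hc,
    lintegral_natCast_mul_poissonMeasure r fun n => g n]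
  simp

/-- Size-biasing one Poisson coordinate of an independent family amounts to adding one to it. -/
lemma setLIntegral_eval_of_iIndepFun_poisson {Ω ι : Type*} [MeasurableSpace Ω] [Fintype ι]
    [DecidableEq ι] {P : Measure Ω} [IsProbabilityMeasure P] {N : ι → Ω → ℝ≥0∞}
    (hN : ∀ i, Measurable (N i)) (hind : iIndepFun N P) {j : ι} {r : ℝ≥0}
    (h : P.map (N j) = (poissonMeasure r).map (fun n : ℕ => (n : ℝ≥0∞)))
    {E : Set (ι → ℝ≥0∞)} (hE : MeasurableSet E) :
    ∫⁻ ω in {ω | (fun i => N i ω) ∈ E}, N j ω ∂P =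
      r * P {ω | (fun i => N i ω) + Pi.single j 1 ∈ E} := by
  have hN' : Measurable fun ω i => N i ω := measurable_pi_lambda _ hN
  have hN1 : Measurable fun ω => (fun i => N i ω) + Pi.single j (1 : ℝ≥0∞) := hN'.add_const _
  have hmean : ∫⁻ ω, N j ω ∂P = r := by
    simpa using lintegral_mul_comp_of_map_eq_poisson (hN j) h (g := fun _ => 1) measurable_const
  have hfin : IsFiniteMeasure ((P.withDensity (N j)).map fun ω i => N i ω) := by
    constructor
    rw [Measure.map_apply hN' .univ, Set.preimage_univ, withDensity_apply _ .univ,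
      Measure.restrict_univ, hmean]
    exact ENNReal.coe_lt_top
  -- Equal finite measures on the space of vectors, by comparison on boxes.
  have key : (P.withDensity (N j)).map (fun ω i => N i ω) =
      (r : ℝ≥0∞) • P.map (fun ω => (fun i => N i ω) + Pi.single j 1) := by
    refine ext_of_generate_finite _ generateFrom_pi.symm isPiSystem_pi ?_ ?_
    · rintro _ ⟨s, hs, rfl⟩
      have hs' (i : ι) : MeasurableSet (s i) := hs i (Set.mem_univ i)
      have hpi : MeasurableSet (Set.univ.pi s) := .univ_pi hs'
      rw [Measure.map_apply hN' hpi, withDensity_apply _ (hN' hpi), Measure.smul_apply,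
        Measure.map_apply hN1 hpi, ← lintegral_indicator (hN' hpi),
        ← lintegral_indicator_one (hN1 hpi)]
      -- Both integrands are products of functions of the single coordinates.
      let u (i : ι) (t : ℝ≥0∞) : ℝ≥0∞ := (if i = j then t else 1) * (s i).indicator 1 t
      let v (i : ι) (t : ℝ≥0∞) : ℝ≥0∞ := (s i).indicator 1 (t + if i = j then 1 else 0)
      have hu (i : ι) : Measurable (u i) := by
        refine Measurable.mul ?_ (measurable_one.indicator (hs' i))
        split_ifs
        exacts [measurable_id, measurable_const]
      have hv (i : ι) : Measurable (v i) :=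
        (measurable_one.indicator (hs' i)).comp (measurable_id.add_const _)
      have e1 (ω : Ω) : ((fun ω i => N i ω) ⁻¹' Set.univ.pi s).indicator (N j) ω =
          ∏ i, u i (N i ω) := by
        simp only [u, Finset.prod_mul_distrib, Finset.prod_ite_eq', Finset.mem_univ, if_true]
        by_cases hω : ∀ i, N i ω ∈ s i
        · simp [Set.indicator, hω]
        · obtain ⟨i, hi⟩ := not_forall.1 hω
          rw [Finset.prod_eq_zero (Finset.mem_univ i) (by simp [hi])]
          simp [Set.indicator, hω]
      have e2 (ω : Ω) : ((fun ω => (fun i => N i ω) + Pi.single j 1) ⁻¹'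
          Set.univ.pi s).indicator 1 ω = ∏ i, v i (N i ω) := by
        by_cases hω : ∀ i, N i ω + (if i = j then 1 else 0) ∈ s i
        · simp [Set.indicator, hω, v, Pi.single_apply]
        · obtain ⟨i, hi⟩ := not_forall.1 hω
          rw [Finset.prod_eq_zero (Finset.mem_univ i) (by simp [hi, v])]
          simp [Set.indicator, hω, Pi.single_apply]
      simp_rw [e1, e2]
      rw [lintegral_prod_eq_prod_lintegral_of_indepFun _ (fun i ω => u i (N i ω))
          (hind.comp u hu) (fun i => (hu i).comp (hN i)),
        lintegral_prod_eq_prod_lintegral_of_indepFun _ (fun i ω => v i (N i ω))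
          (hind.comp v hv) (fun i => (hv i).comp (hN i)),
        ← Finset.mul_prod_erase _ _ (Finset.mem_univ j),
        ← Finset.mul_prod_erase _ _ (Finset.mem_univ j), smul_eq_mul, ← mul_assoc]
      congr 1
      · simpa [u, v] using lintegral_mul_comp_of_map_eq_poisson (hN j) h
          (measurable_one.indicator (hs' j))
      · refine Finset.prod_congr rfl fun i hi => ?_
        simp [u, v, Finset.ne_of_mem_erase hi]
    · rw [Measure.map_apply hN' .univ, Set.preimage_univ, withDensity_apply _ .univ,
        Measure.restrict_univ, hmean, Measure.smul_apply, Measure.map_apply hN1 .univ]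
      simp
  have := congrArg (fun ν => ν E) key
  simp only [Measure.map_apply hN' hE, Measure.smul_apply, Measure.map_apply hN1 hE,
    withDensity_apply _ (hN' hE), smul_eq_mul] at this
  exact this

namespace Configuration

variable {X : Type*} [TopologicalSpace X] [MeasurableSpace X]

/-- The vector of the numbers of points of `ω` in the cells `φ ⁻¹' {i}` of the partition of the
space into the level sets of `φ`. -/
noncomputable def cellCounts {n : ℕ} (φ : X → Fin n) (ω : Configuration X) : Fin n → ℝ≥0∞ :=
  fun i => ω.toMeasure (φ ⁻¹' {i})

lemma measurable_cellCounts {n : ℕ} {φ : X → Fin n} (hφ : Measurable φ) :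
    Measurable (cellCounts φ) :=
  measurable_pi_lambda _ fun i => measurable_toMeasure_apply (hφ (measurableSet_singleton i))

lemma cellCounts_comp {n m : ℕ} {φ : X → Fin n} (hφ : Measurable φ) (p : Fin n → Fin m)
    (ω : Configuration X) :
    cellCounts (p ∘ φ) ω = fun i => ∑ k with p k = i, cellCounts φ ω k := by
  ext i
  simp only [cellCounts]
  rw [← measure_biUnion_finset]
  · congr 1
    ext x
    simp
  · intro a _ b _ hab
    exact Disjoint.preimage _ (by simpa using hab)
  · exact fun a _ => hφ (measurableSet_singleton a)

lemma measurable_sum_fibers {n m : ℕ} (p : Fin n → Fin m) :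
    Measurable fun (v : Fin n → ℝ≥0∞) (i : Fin m) => ∑ k with p k = i, v k :=
  measurable_pi_lambda _ fun _ => Finset.measurable_sum _ fun k _ => measurable_pi_apply k

variable (X) in
/-- The events determined by the numbers of points in the cells of some finite measurable
partition of the space. -/
def cylinders : Set (Set (Configuration X)) :=
  {F | ∃ (n : ℕ) (φ : X → Fin n) (E : Set (Fin n → ℝ≥0∞)), Measurable φ ∧ MeasurableSet E ∧
    F = cellCounts φ ⁻¹' E}

/-- An event determined by the cells of `p ∘ φ` is determined by the cells of `φ`. -/
lemma exists_preimage_cellCounts_comp {n m : ℕ} {φ : X → Fin n} (hφ : Measurable φ)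
    (p : Fin n → Fin m) {E : Set (Fin m → ℝ≥0∞)} (hE : MeasurableSet E) :
    ∃ E' : Set (Fin n → ℝ≥0∞), MeasurableSet E' ∧
      cellCounts (p ∘ φ) ⁻¹' E = cellCounts φ ⁻¹' E' := by
  refine ⟨_, measurable_sum_fibers p hE, ?_⟩
  ext ω
  simp [cellCounts_comp hφ]

lemma isPiSystem_cylinders : IsPiSystem (cylinders X) := by
  rintro _ ⟨n, φ, E, hφ, hE, rfl⟩ _ ⟨m, ψ, E', hψ, hE', rfl⟩ -
  let χ (x : X) : Fin (n * m) := finProdFinEquiv (φ x, ψ x)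
  have hχ : Measurable χ := Measurable.of_discrete.comp (hφ.prodMk hψ)
  have h1 : (fun k => (finProdFinEquiv.symm k).1) ∘ χ = φ := by
    funext x; simp only [χ, Function.comp_apply, Equiv.symm_apply_apply]
  have h2 : (fun k => (finProdFinEquiv.symm k).2) ∘ χ = ψ := by
    funext x; simp only [χ, Function.comp_apply, Equiv.symm_apply_apply]
  obtain ⟨F, hF, hF'⟩ :=
    exists_preimage_cellCounts_comp hχ (fun k => (finProdFinEquiv.symm k).1) hE
  obtain ⟨G, hG, hG'⟩ :=
    exists_preimage_cellCounts_comp hχ (fun k => (finProdFinEquiv.symm k).2) hE'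
  rw [h1] at hF'
  rw [h2] at hG'
  exact ⟨n * m, χ, F ∩ G, hχ, hF.inter hG, by rw [hF', hG', Set.preimage_inter]⟩

lemma univ_mem_cylinders : Set.univ ∈ cylinders X :=
  ⟨1, fun _ => 0, Set.univ, measurable_const, .univ, rfl⟩

open Classical in
lemma generateFrom_cylinders :
    MeasurableSpace.generateFrom (cylinders X) = instMeasurableSpace := by
  apply le_antisymm
  · refine MeasurableSpace.generateFrom_le ?_
    rintro _ ⟨n, φ, E, hφ, hE, rfl⟩
    exact measurable_cellCounts hφ hE
  · refine iSup₂_le fun A hA => ?_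
    rintro _ ⟨s, hs, rfl⟩
    refine MeasurableSpace.measurableSet_generateFrom
      ⟨2, fun x => if x ∈ A then 1 else 0, (fun v => v 1) ⁻¹' s, ?_, measurable_pi_apply 1 hs, ?_⟩
    · exact Measurable.ite hA measurable_const measurable_const
    · ext ω
      have : (fun x => if x ∈ A then (1 : Fin 2) else 0) ⁻¹' {1} = A := by ext x; simp
      simp [cellCounts, this]

end Configuration

/-! ### The univariate Mecke formula -/

namespace IsPoissonMeasure

open Configuration

lemma setLIntegral_cellCounts {X : Type*} [TopologicalSpace X] [MeasurableSpace X]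
    {P : Measure (Configuration X)} {σ : Measure X} (hP : IsPoissonMeasure P σ) {n : ℕ}
    {φ : X → Fin n} (hφ : Measurable φ) (j : Fin n) (hj : σ (φ ⁻¹' {j}) ≠ ∞)
    {E : Set (Fin n → ℝ≥0∞)} (hE : MeasurableSet E) :
    ∫⁻ ω in cellCounts φ ⁻¹' E, ω.toMeasure (φ ⁻¹' {j}) ∂P =
      σ (φ ⁻¹' {j}) * P {ω | cellCounts φ ω + Pi.single j 1 ∈ E} := by
  have := hP.isProbabilityMeasure
  have hm (i : Fin n) : MeasurableSet (φ ⁻¹' {i}) := hφ (measurableSet_singleton i)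
  lift σ (φ ⁻¹' {j}) to ℝ≥0 using hj with r hr
  exact setLIntegral_eval_of_iIndepFun_poisson (fun i => measurable_toMeasure_apply (hm i))
    (hP.iIndepFun n _ hm fun i k hik => Disjoint.preimage _ (by simpa using hik))
    (hP.map_eq_poisson _ r (hm j) hr.symm) hE

section Campbell

variable {X : Type*} [TopologicalSpace X] [MeasurableSpace X] [MeasurableSingletonClass X]
  {P : Measure (Configuration X)} {σ : Measure X}

lemma ae_notMem_carrier [NullSingletonClass σ] (hP : IsPoissonMeasure P σ) (x : X) :
    ∀ᵐ ω ∂P, x ∉ ω.carrier := by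
  have h := hP.map_eq_poisson {x} 0 (measurableSet_singleton x) (by simp)
  have h0 : MeasurableSet {(0 : ℝ≥0∞)}ᶜ := (measurableSet_singleton 0).compl
  have h1 : P.map (fun ω => ω.toMeasure {x}) {(0 : ℝ≥0∞)}ᶜ = 0 := by
    rw [h, Measure.map_apply measurable_from_nat h0, poissonMeasure,
      Measure.sum_apply _ (measurable_from_nat h0), ENNReal.tsum_eq_zero]
    rintro (_ | n) <;> simp
  rw [Measure.map_apply (measurable_toMeasure_apply (measurableSet_singleton x)) h0] at h1
  filter_upwards [measure_eq_zero_iff_ae_notMem.1 h1] with ω hω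
  simpa [toMeasure_singleton_eq_zero] using hω

/-- The univariate Mecke formula on rectangles `B × F`. -/
lemma setLIntegral_toMeasure [NullSingletonClass σ] (hP : IsPoissonMeasure P σ) {B : Set X}
    (hB : MeasurableSet B) (hσB : σ B ≠ ∞) {F : Set (Configuration X)} (hF : F ∈ cylinders X) :
    ∫⁻ ω in F, ω.toMeasure B ∂P = ∫⁻ x in B, P {ω | ω.addPoints ![x] ∈ F} ∂σ := by
  classical
  obtain ⟨n, φ, E, hφ, hE, rfl⟩ := hF
  -- Refine the partition so that `B` becomes a union of cells.
  let χ (x : X) : Fin (n * 2) := finProdFinEquiv (φ x, if x ∈ B then 1 else 0)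
  have hχ : Measurable χ := Measurable.of_discrete.comp
    (hφ.prodMk (Measurable.ite hB measurable_const measurable_const))
  have hm (i : Fin (n * 2)) : MeasurableSet (χ ⁻¹' {i}) := hχ (measurableSet_singleton i)
  have hd (s : Set (Fin (n * 2))) : s.PairwiseDisjoint fun k => χ ⁻¹' {k} :=
    fun a _ b _ hab => Disjoint.preimage _ (by simpa using hab)
  have h1 : (fun k => (finProdFinEquiv.symm k).1) ∘ χ = φ := by
    funext x; simp only [χ, Function.comp_apply, Equiv.symm_apply_apply]
  obtain ⟨E', hE', hEE'⟩ :=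
    exists_preimage_cellCounts_comp hχ (fun k => (finProdFinEquiv.symm k).1) hE
  rw [h1] at hEE'
  rw [hEE']
  let T : Finset (Fin (n * 2)) := {k | (finProdFinEquiv.symm k).2 = 1}
  have hBT : B = ⋃ k ∈ T, χ ⁻¹' {k} := by
    ext x
    simp only [T, Set.mem_iUnion, Set.mem_preimage, Set.mem_singleton_iff, Finset.mem_filter,
      Finset.mem_univ, true_and, exists_prop, exists_eq_right', χ, Equiv.symm_apply_apply]
    by_cases hx : x ∈ B <;> simp [hx]
  have hcell (k) (hk : k ∈ T) : σ (χ ⁻¹' {k}) ≠ ∞ :=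
    measure_ne_top_of_subset (hBT ▸ Set.subset_biUnion_of_mem (u := fun k => χ ⁻¹' {k}) hk) hσB
  have hω (ω : Configuration X) : ω.toMeasure B = ∑ k ∈ T, ω.toMeasure (χ ⁻¹' {k}) := by
    conv_lhs => rw [hBT]
    exact measure_biUnion_finset (hd _) fun k _ => hm k
  simp_rw [hω]
  rw [lintegral_finsetSum _ fun k _ => measurable_toMeasure_apply (hm k)]
  conv_rhs => rw [hBT]
  rw [lintegral_biUnion_finset (hd _) fun k _ => hm k]
  refine Finset.sum_congr rfl fun k hk => ?_
  -- Almost surely, a new point in the cell `k` raises the number of points there by one.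
  have hconst : ∀ x ∈ χ ⁻¹' {k}, P {ω | ω.addPoints ![x] ∈ cellCounts χ ⁻¹' E'} =
      P {ω | cellCounts χ ω + Pi.single k 1 ∈ E'} := by
    intro x hx
    refine measure_congr ?_
    filter_upwards [hP.ae_notMem_carrier x] with ω hxω
    have : cellCounts χ (ω.addPoints ![x]) = cellCounts χ ω + Pi.single k 1 := by
      ext i
      have hx' : χ x = k := hx
      simp only [cellCounts, toMeasure_addPoints_singleton ω hxω (hm i), Pi.add_apply]
      by_cases hi : i = k
      · subst hi; simp [Set.indicator, hx']
      · simp [Set.indicator, hx', hi, Ne.symm hi]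
    change (cellCounts χ (ω.addPoints ![x]) ∈ E') = (cellCounts χ ω + Pi.single k 1 ∈ E')
    rw [this]
  rw [hP.setLIntegral_cellCounts hχ k (hcell k hk) hE', setLIntegral_congr_fun (hm k) hconst,
    setLIntegral_const, mul_comm]

end Campbell

section Mecke

variable {X : Type*} [TopologicalSpace X] [T2Space X] [SecondCountableTopology X]
  [SigmaCompactSpace X] [MeasurableSpace X] [BorelSpace X]
  {P : Measure (Configuration X)} {σ : Measure X}

/-- The Mecke equation for measures: choosing a point of `ω` with weight one for each point gives
the same measure on configurations times points as adding to `ω` a point distributed according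
to `σ`. -/
lemma compProd_toKernel_eq_map [SigmaFinite σ] [NullSingletonClass σ]
    (hP : IsPoissonMeasure P σ) :
    P ⊗ₘ toKernel X =
      (P.prod σ).map fun p : Configuration X × X => (p.1.addPoints ![p.2], p.2) := by
  have := hP.isProbabilityMeasure
  have hT : Measurable fun p : Configuration X × X => (p.1.addPoints ![p.2], p.2) :=
    measurable_addPoints_singleton.prodMk measurable_snd
  have hcyl {F : Set (Configuration X)} (hF : F ∈ cylinders X) : MeasurableSet F := by
    rw [← generateFrom_cylinders]
    exact MeasurableSpace.measurableSet_generateFrom hF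
  have hM1 {F : Set (Configuration X)} (hF : MeasurableSet F) {B : Set X} (hB : MeasurableSet B) :
      (P ⊗ₘ toKernel X) (F ×ˢ B) = ∫⁻ ω in F, ω.toMeasure B ∂P := by
    rw [Measure.compProd_apply_prod hF hB]; rfl
  have hM2 {F : Set (Configuration X)} (hF : MeasurableSet F) {B : Set X} (hB : MeasurableSet B) :
      (P.prod σ).map (fun p : Configuration X × X => (p.1.addPoints ![p.2], p.2)) (F ×ˢ B) =
        ∫⁻ x in B, P {ω | ω.addPoints ![x] ∈ F} ∂σ := by
    rw [Measure.map_apply hT (hF.prod hB), Measure.prod_apply_symm (hT (hF.prod hB)),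
      ← lintegral_indicator hB]
    refine lintegral_congr fun x => ?_
    by_cases hx : x ∈ B
    · simp only [Set.indicator_of_mem hx]
      congr 1
      ext ω
      simp [hx]
    · simp [hx, Set.preimage, Set.indicator]
  have heq {F : Set (Configuration X)} (hF : F ∈ cylinders X) {B : Set X} (hB : MeasurableSet B)
      (hσ : σ B ≠ ∞) : (P ⊗ₘ toKernel X) (F ×ˢ B) =
      (P.prod σ).map (fun p : Configuration X × X => (p.1.addPoints ![p.2], p.2)) (F ×ˢ B) := by
    rw [hM1 (hcyl hF) hB, hM2 (hcyl hF) hB, hP.setLIntegral_toMeasure hB hσ hF]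
  have hsp : ⋃ i, spanningSets σ i = Set.univ := iUnion_spanningSets σ
  have hgenX : MeasurableSpace.generateFrom {B : Set X | MeasurableSet B ∧ σ B ≠ ∞} =
      (inferInstance : MeasurableSpace X) := by
    refine le_antisymm (MeasurableSpace.generateFrom_le fun B hB => hB.1) fun A hA => ?_
    rw [← Set.inter_univ A, ← hsp, Set.inter_iUnion]
    refine .iUnion fun i => MeasurableSpace.measurableSet_generateFrom
      ⟨hA.inter (measurableSet_spanningSets σ i), ?_⟩
    exact measure_ne_top_of_subset Set.inter_subset_right (measure_spanningSets_lt_top σ i).ne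
  have hmem (i : ℕ) : spanningSets σ i ∈ {B : Set X | MeasurableSet B ∧ σ B ≠ ∞} :=
    ⟨measurableSet_spanningSets σ i, (measure_spanningSets_lt_top σ i).ne⟩
  refine Measure.ext_of_generateFrom_of_iUnion
    (Set.image2 (· ×ˢ ·) (cylinders X) {B : Set X | MeasurableSet B ∧ σ B ≠ ∞})
    (fun i => Set.univ ×ˢ spanningSets σ i) ?_ ?_ ?_ ?_ ?_ ?_
  · exact (generateFrom_eq_prod generateFrom_cylinders hgenX
      ⟨fun _ => Set.univ, fun _ => univ_mem_cylinders, Set.iUnion_const _⟩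
      ⟨spanningSets σ, hmem, hsp⟩).symm
  · refine isPiSystem_cylinders.prod ?_
    rintro A ⟨hA, hA'⟩ B ⟨hB, -⟩ -
    exact ⟨hA.inter hB, measure_ne_top_of_subset Set.inter_subset_left hA'⟩
  · rw [← Set.prod_iUnion, hsp, Set.univ_prod_univ]
  · exact fun i => ⟨_, univ_mem_cylinders, _, hmem i, rfl⟩
  · intro i
    rw [heq univ_mem_cylinders (hmem i).1 (hmem i).2, hM2 .univ (hmem i).1]
    simpa using (hmem i).2
  · rintro _ ⟨F, hF, B, hB, rfl⟩
    exact heq hF hB.1 hB.2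

/-- The univariate Mecke formula. -/
theorem lintegral_lintegral_toMeasure [SigmaFinite σ] [NullSingletonClass σ]
    (hP : IsPoissonMeasure P σ) {g : Configuration X → X → ℝ≥0∞}
    (hg : Measurable (Function.uncurry g)) :
    ∫⁻ ω, ∫⁻ x, g ω x ∂ω.toMeasure ∂P = ∫⁻ x, ∫⁻ ω, g (ω.addPoints ![x]) x ∂P ∂σ := by
  have := hP.isProbabilityMeasure
  have hT : Measurable fun p : Configuration X × X => (p.1.addPoints ![p.2], p.2) :=
    measurable_addPoints_singleton.prodMk measurable_snd
  have h := congrArg (fun μ => ∫⁻ p, Function.uncurry g p ∂μ) hP.compProd_toKernel_eq_map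
  simp only [Measure.lintegral_compProd hg, lintegral_map hg hT] at h
  exact h.trans (lintegral_prod_symm _ (hg.comp hT).aemeasurable)

end Mecke

end IsPoissonMeasure

/-! ### Factorial sums and the multivariate Mecke formula -/

namespace Configuration

/-- The sum of `g` over all `k`-tuples of pairwise different points of the configuration, that is,
the integral of `g` against the `k`-th factorial measure of `ω`. -/
noncomputable def factorialSum {X : Type*} [TopologicalSpace X] {k : ℕ} (ω : Configuration X)
    (g : (Fin k → X) → ℝ≥0∞) : ℝ≥0∞ :=
  ∑' e : Fin k ↪ ω.carrier, g fun i => e i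

section Combinatorics

variable {X : Type*} [TopologicalSpace X] {k : ℕ} (ω : Configuration X)

lemma factorialSum_zero (g : (Fin 0 → X) → ℝ≥0∞) : ω.factorialSum g = g ![] := by
  rw [factorialSum, tsum_fintype, Fintype.sum_unique]
  congr 1
  exact Subsingleton.elim _ _

lemma factorialSum_add (g h : (Fin k → X) → ℝ≥0∞) :
    ω.factorialSum (fun v => g v + h v) = ω.factorialSum g + ω.factorialSum h :=
  ENNReal.tsum_add

lemma factorialSum_comp_perm (π : Equiv.Perm (Fin k)) (g : (Fin k → X) → ℝ≥0∞) :
    ω.factorialSum (fun v => g fun i => v (π i)) = ω.factorialSum g :=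
  (Equiv.embeddingCongr π.symm (Equiv.refl ω.carrier)).tsum_eq
    fun e : Fin k ↪ ω.carrier => g fun i => e i

lemma factorialSum_congr {g h : (Fin k → X) → ℝ≥0∞}
    (H : ∀ v, Function.Injective v → g v = h v) : ω.factorialSum g = ω.factorialSum h :=
  tsum_congr fun e => H _ (Subtype.val_injective.comp e.injective)

open Classical in
/-- The new point `y` is the first entry of the longer tuple, the head of `Fin.cons y v`. -/
lemma factorialSum_succ (g : (Fin (k + 1) → X) → ℝ≥0∞) :
    ω.factorialSum g = ω.factorialSum fun v =>
      ∑' y : ω.carrier, if (y : X) ∈ Set.range v then 0 else g (Fin.cons (y : X) v) := by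
  rw [factorialSum, factorialSum, ← (Equiv.embeddingFinSucc k ω.carrier).symm.tsum_eq,
    ENNReal.tsum_sigma']
  refine tsum_congr fun e => ?_
  have hmem (y : ω.carrier) : ((y : X) ∈ Set.range fun i => (e i : X)) ↔ y ∈ Set.range e := by
    simp [Subtype.ext_iff]
  have h := tsum_subtype {y : ω.carrier | y ∉ Set.range e}
    fun y => g (Fin.cons (y : X) fun i => (e i : X))
  refine Eq.trans (tsum_congr fun y => ?_) (h.trans (tsum_congr fun y => ?_))
  · congr 1
    ext i
    rw [Equiv.coe_embeddingFinSucc_symm]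
    exact Fin.cases rfl (fun _ => rfl) i
  · by_cases hy : y ∈ Set.range e
    · rw [if_pos ((hmem y).2 hy), Set.indicator_of_notMem (by simpa using hy)]
    · rw [if_neg (mt (hmem y).1 hy), Set.indicator_of_mem (by simpa using hy)]

open Classical in
/-- Tuples of points of `ω ∪ {y}` avoiding `y` are tuples of points of `ω`. -/
lemma factorialSum_addPoints_singleton {y : X} (hy : y ∉ ω.carrier) (g : (Fin k → X) → ℝ≥0∞) :
    ((ω.addPoints ![y]).factorialSum fun v => if y ∈ Set.range v then 0 else g v) =
      ω.factorialSum g := by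
  have hsub : ω.carrier ⊆ (ω.addPoints ![y]).carrier := Set.subset_union_left
  let J : (Fin k ↪ ω.carrier) → (Fin k ↪ (ω.addPoints ![y]).carrier) :=
    fun e => e.trans (Set.embeddingOfSubset _ _ hsub)
  have hJ : Function.Injective J := fun e e' h => by
    ext i
    simpa [J, Set.embeddingOfSubset, Subtype.ext_iff] using DFunLike.congr_fun h i
  rw [factorialSum, factorialSum, ← hJ.tsum_eq]
  · refine tsum_congr fun e => if_neg ?_
    rintro ⟨i, hi⟩
    exact hy (hi ▸ (e i).2)
  · intro e he
    have hne : ∀ i, (e i : X) ∈ ω.carrier := by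
      intro i
      rcases (e i).2 with h | ⟨a, ha⟩
      · exact h
      · refine absurd (if_pos ⟨i, ?_⟩) he
        change (e i : X) = y
        rw [← ha]
        simp
    refine ⟨⟨fun i => ⟨e i, hne i⟩, fun i j hij => e.injective (Subtype.ext ?_)⟩, ?_⟩
    · simpa using hij
    · ext i; rfl

end Combinatorics

section Measurability

/-- A further sum over all points of the configuration splits according to whether the new point
is one of the old ones. -/
lemma factorialSum_lintegral {X : Type*} [TopologicalSpace X] [MeasurableSpace X]
    [MeasurableSingletonClass X] {k : ℕ} (ω : Configuration X) (h : (Fin k → X) → X → ℝ≥0∞) :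
    (ω.factorialSum fun v => ∫⁻ y, h v y ∂ω.toMeasure) =
      ∑ i, (ω.factorialSum fun v => h v (v i)) +
        ω.factorialSum fun v : Fin (k + 1) → X => h (Fin.tail v) (v 0) := by
  classical
  simp_rw [lintegral_toMeasure]
  have hsum : ∑ i, (ω.factorialSum fun v => h v (v i)) =
      ω.factorialSum fun v => ∑ i, h v (v i) := by
    simp only [factorialSum]
    simp_rw [← tsum_fintype (L := .unconditional _)]
    exact ENNReal.tsum_comm
  rw [factorialSum_succ, hsum, ← factorialSum_add]
  refine tsum_congr fun e => ?_
  have hmem (y : ω.carrier) : ((y : X) ∈ Set.range fun i => (e i : X)) ↔ y ∈ Set.range e := by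
    simp [Subtype.ext_iff]
  have h1 : ∑ i, h (fun i => e i) (e i) = ∑' y : ω.carrier,
      if (y : X) ∈ Set.range fun i => (e i : X) then h (fun i => e i) y else 0 := by
    rw [← e.injective.tsum_eq, tsum_fintype]
    · exact Finset.sum_congr rfl fun i _ => (if_pos ⟨i, rfl⟩).symm
    · intro y hy
      by_contra hc
      exact hy (if_neg (mt (hmem y).1 hc))
  beta_reduce
  rw [h1, ← ENNReal.tsum_add]
  refine tsum_congr fun y => ?_
  split_ifs <;> simp

open Classical in
lemma factorialSum_succ_eq_lintegral {X : Type*} [TopologicalSpace X] [MeasurableSpace X]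
    [MeasurableSingletonClass X] {k : ℕ} (ω : Configuration X) (g : (Fin (k + 1) → X) → ℝ≥0∞) :
    ω.factorialSum g = ∫⁻ y, ω.factorialSum
      (fun v => if y ∈ Set.range v then 0 else g (Fin.cons y v)) ∂ω.toMeasure := by
  rw [factorialSum_succ, lintegral_toMeasure, factorialSum, ENNReal.tsum_comm]
  rfl

lemma measurable_finCons {X : Type*} [MeasurableSpace X] {k : ℕ} :
    Measurable fun p : X × (Fin k → X) => (Fin.cons p.1 p.2 : Fin (k + 1) → X) := by
  refine measurable_pi_lambda _ fun i => ?_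
  refine Fin.cases measurable_fst (fun j => ?_) i
  exact (measurable_pi_apply j).comp measurable_snd

lemma measurableSet_mem_range {X : Type*} [MeasurableSpace X] [MeasurableEq X] {k : ℕ} :
    MeasurableSet {p : X × (Fin k → X) | p.1 ∈ Set.range p.2} := by
  have : {p : X × (Fin k → X) | p.1 ∈ Set.range p.2} = ⋃ i, {p | p.2 i = p.1} := by
    ext; simp
  rw [this]
  exact .iUnion fun i =>
    measurableSet_eq_fun ((measurable_pi_apply i).comp measurable_snd) measurable_fst

universe u

variable {X : Type u} [TopologicalSpace X] [T2Space X] [SecondCountableTopology X]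
  [SigmaCompactSpace X] [MeasurableSpace X] [BorelSpace X]

/-- Factorial sums depend measurably on parameters. The parameter type is arbitrary because the
induction on `k` turns the first point of the tuple into a further parameter. -/
lemma measurable_factorialSum {k : ℕ} {A : Type u} [MeasurableSpace A] {F : A → Configuration X}
    (hF : Measurable F) {g : A → (Fin k → X) → ℝ≥0∞} (hg : Measurable (Function.uncurry g)) :
    Measurable fun a => (F a).factorialSum (g a) := by
  classical
  induction k generalizing A with
  | zero =>
    simp_rw [factorialSum_zero]
    exact hg.comp (measurable_id.prodMk measurable_const)
  | succ k ih =>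
    simp_rw [factorialSum_succ_eq_lintegral]
    refine Measurable.lintegral_kernel_prod_right (κ := (toKernel X).comap F hF) ?_
    refine ih (hF.comp measurable_fst) (g := fun (p : A × X) v =>
      if p.2 ∈ Set.range v then 0 else g p.1 (Fin.cons p.2 v)) ?_
    refine Measurable.ite (measurableSet_mem_range.preimage
      ((measurable_snd.comp measurable_fst).prodMk measurable_snd)) measurable_const ?_
    exact hg.comp ((measurable_fst.comp measurable_fst).prodMk
      (measurable_finCons.comp ((measurable_snd.comp measurable_fst).prodMk measurable_snd)))

end Measurability

end Configuration

namespace IsPoissonMeasure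

open Configuration

universe u

variable {X : Type u} [TopologicalSpace X] [T2Space X] [SecondCountableTopology X]
  [SigmaCompactSpace X] [MeasurableSpace X] [BorelSpace X]
  {P : Measure (Configuration X)} {σ : Measure X}

/-- The multivariate Mecke formula. -/
theorem lintegral_factorialSum [SigmaFinite σ] [NullSingletonClass σ]
    (hP : IsPoissonMeasure P σ) {k : ℕ} {g : Configuration X → (Fin k → X) → ℝ≥0∞}
    (hg : Measurable (Function.uncurry g)) :
    ∫⁻ ω, ω.factorialSum (g ω) ∂P =
      ∫⁻ x, ∫⁻ ω, g (ω.addPoints x) x ∂P ∂(Measure.pi fun _ : Fin k => σ) := by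
  classical
  have := hP.isProbabilityMeasure
  induction k with
  | zero =>
    simp_rw [factorialSum_zero, addPoints_zero]
    rw [Measure.pi_of_empty _ ![], lintegral_dirac]
  | succ k ih =>
    simp_rw [factorialSum_succ_eq_lintegral]
    have hh : Measurable (Function.uncurry fun (ω : Configuration X) (y : X) => ω.factorialSum
        fun v => if y ∈ Set.range v then 0 else g ω (Fin.cons y v)) := by
      refine measurable_factorialSum measurable_fst (g := fun (p : Configuration X × X) v =>
        if p.2 ∈ Set.range v then 0 else g p.1 (Fin.cons p.2 v)) ?_
      refine Measurable.ite (measurableSet_mem_range.preimage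
        ((measurable_snd.comp measurable_fst).prodMk measurable_snd)) measurable_const ?_
      exact hg.comp ((measurable_fst.comp measurable_fst).prodMk
        (measurable_finCons.comp ((measurable_snd.comp measurable_fst).prodMk measurable_snd)))
    rw [hP.lintegral_lintegral_toMeasure hh]
    have hy (y : X) : ∫⁻ ω, (ω.addPoints ![y]).factorialSum
          (fun v => if y ∈ Set.range v then 0 else g (ω.addPoints ![y]) (Fin.cons y v)) ∂P =
        ∫⁻ x, ∫⁻ ω, g (ω.addPoints (Fin.cons y x : Fin (k + 1) → X)) (Fin.cons y x) ∂P
          ∂(Measure.pi fun _ : Fin k => σ) := by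
      have hgy : Measurable (Function.uncurry fun (ω : Configuration X) (v : Fin k → X) =>
          g (ω.addPoints ![y]) (Fin.cons y v)) :=
        hg.comp ((measurable_addPoints_singleton.comp
          (measurable_fst.prodMk measurable_const)).prodMk
            (measurable_finCons.comp (measurable_const.prodMk measurable_snd)))
      simp_rw [addPoints_cons]
      rw [← ih hgy]
      refine lintegral_congr_ae ?_
      -- Off the null event `y ∈ ω`, the tuples of `ω ∪ {y}` avoiding `y` are those of `ω`.
      filter_upwards [hP.ae_notMem_carrier y] with ω hω
      exact factorialSum_addPoints_singleton ω hω _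
    simp_rw [hy]
    have hG : Measurable fun z : Fin (k + 1) → X => ∫⁻ ω, g (ω.addPoints z) z ∂P :=
      Measurable.lintegral_prod_right' (f := fun p : (Fin (k + 1) → X) × Configuration X =>
        g (p.2.addPoints p.1) p.1)
        (hg.comp (((measurable_addPoints _).comp measurable_swap).prodMk measurable_fst))
    have hpres := (measurePreserving_piFinSuccAbove (fun _ : Fin (k + 1) => σ) 0).symm
    rw [← hpres.lintegral_comp hG, lintegral_prod]
    · simp [MeasurableEquiv.piFinSuccAbove, Fin.insertNthEquiv]
    · exact (hG.comp (MeasurableEquiv.measurable _)).aemeasurable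

end IsPoissonMeasure

/-! ### The second moment of a double sum -/

namespace Configuration

/-- The sum of `F (x a) (x b) * F (x c) (x d)` over all `k`-tuples `x` of pairwise different points
of the configuration. -/
noncomputable def pairSum {X : Type*} [TopologicalSpace X] {k : ℕ} (ω : Configuration X)
    (F : X → X → ℝ≥0∞) (a b c d : Fin k) : ℝ≥0∞ :=
  ω.factorialSum fun v => F (v a) (v b) * F (v c) (v d)

lemma pairSum_perm {X : Type*} [TopologicalSpace X] {k : ℕ} (ω : Configuration X)
    (F : X → X → ℝ≥0∞) (π : Equiv.Perm (Fin k)) (a b c d : Fin k) :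
    ω.pairSum F (π a) (π b) (π c) (π d) = ω.pairSum F a b c d :=
  ω.factorialSum_comp_perm π fun v => F (v a) (v b) * F (v c) (v d)

lemma pairSum_comm {X : Type*} [TopologicalSpace X] {k : ℕ} (ω : Configuration X)
    (F : X → X → ℝ≥0∞) (a b c d : Fin k) : ω.pairSum F a b c d = ω.pairSum F c d a b := by
  simp only [pairSum, mul_comm]

/-- The square of a double sum, split according to which of the four points coincide. -/
lemma sq_lintegral_lintegral_toMeasure {X : Type*} [TopologicalSpace X] [MeasurableSpace X]
    [MeasurableSingletonClass X] (ω : Configuration X) (F : X → X → ℝ≥0∞) :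
    (∫⁻ y, ∫⁻ x, F x y ∂ω.toMeasure ∂ω.toMeasure) ^ 2 =
      ω.pairSum F (k := 1) 0 0 0 0
      + 2 * ω.pairSum F (k := 2) 0 0 0 1
      + 2 * ω.pairSum F (k := 2) 0 0 1 0
      + ω.pairSum F (k := 2) 0 0 1 1
      + ω.pairSum F (k := 2) 0 1 0 1
      + ω.pairSum F (k := 2) 0 1 1 0
      + 2 * ω.pairSum F (k := 3) 0 0 1 2
      + 2 * ω.pairSum F (k := 3) 0 1 2 0
      + ω.pairSum F (k := 3) 0 1 0 2
      + ω.pairSum F (k := 3) 1 0 2 0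
      + ω.pairSum F (k := 4) 0 1 2 3 := by
  have h : (∫⁻ y, ∫⁻ x, F x y ∂ω.toMeasure ∂ω.toMeasure) ^ 2 =
      ω.factorialSum fun _ : Fin 0 → X => ∫⁻ y, ∫⁻ x, ∫⁻ t, ∫⁻ z,
        F x y * F z t ∂ω.toMeasure ∂ω.toMeasure ∂ω.toMeasure ∂ω.toMeasure := by
    simp_rw [lintegral_toMeasure]
    rw [factorialSum_zero, sq]
    simp_rw [ENNReal.tsum_mul_left, ENNReal.tsum_mul_right]
  rw [h]
  simp only [factorialSum_lintegral, Fin.sum_univ_succ, Fin.sum_univ_zero, Fin.tail]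
  -- The iterated splitting yields the fifteen sums below; relabelling the points and exchanging the
  -- two factors brings them to the stated form.
  have h2 := ω.pairSum_perm F (Equiv.swap (0 : Fin 2) 1)
  have h3 := ω.pairSum_perm F (finRotate 3)
  have e1 : ω.pairSum F (k := 2) 1 1 0 1 = ω.pairSum F 0 0 1 0 := h2 0 0 1 0
  have e2 : ω.pairSum F (k := 2) 1 1 1 0 = ω.pairSum F 0 0 0 1 := h2 0 0 0 1
  have e3 : ω.pairSum F (k := 3) 2 2 0 1 = ω.pairSum F 0 0 1 2 :=
    (h3 1 1 2 0).trans (h3 0 0 1 2)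
  have e4 : ω.pairSum F (k := 3) 1 2 0 1 = ω.pairSum F 0 1 2 0 := h3 0 1 2 0
  have e5 : ω.pairSum F (k := 3) 1 2 0 2 = ω.pairSum F 1 0 2 0 :=
    ω.pairSum_perm F (Equiv.swap (0 : Fin 3) 2) 1 0 2 0
  have e6 : ω.pairSum F (k := 3) 1 2 1 0 = ω.pairSum F 0 1 0 2 := h3 0 1 0 2
  have e7 : ω.pairSum F (k := 3) 2 0 1 2 = ω.pairSum F 0 1 2 0 :=
    (h3 1 2 0 1).trans e4
  have c1 := ω.pairSum_comm F (k := 2) 1 1 0 0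
  have c2 := ω.pairSum_comm F (k := 2) 0 1 0 0
  have c3 := (ω.pairSum_comm F (k := 2) 0 1 1 1).trans e1
  have c4 := ω.pairSum_comm F (k := 3) 1 2 0 0
  have c5 := (ω.pairSum_comm F (k := 3) 1 2 2 0).trans e7
  have c6 := ω.pairSum_comm F (k := 4) 2 3 0 1
  change 0 + (((ω.pairSum F (k := 1) 0 0 0 0 + 0 + ω.pairSum F (k := 2) 1 1 0 1) + 0 +
      (ω.pairSum F (k := 2) 1 1 0 0 + (ω.pairSum F (k := 2) 1 1 1 0 + 0) +
        ω.pairSum F (k := 3) 2 2 0 1)) + 0 +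
      ((ω.pairSum F (k := 2) 0 1 0 0 + (ω.pairSum F (k := 2) 0 1 1 0 + 0) +
        ω.pairSum F (k := 3) 1 2 0 1) +
      ((ω.pairSum F (k := 2) 0 1 0 1 + (ω.pairSum F (k := 2) 0 1 1 1 + 0) +
        ω.pairSum F (k := 3) 1 2 0 2) + 0) +
      (ω.pairSum F (k := 3) 1 2 0 0 + (ω.pairSum F (k := 3) 1 2 1 0 +
        (ω.pairSum F (k := 3) 1 2 2 0 + 0)) + ω.pairSum F (k := 4) 2 3 0 1))) = _
  rw [e1, c1, e2, e3, c2, e4, c3, e5, c4, e6, c5, c6]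
  ring

end Configuration

namespace IsPoissonMeasure

open Configuration

lemma measurableSet_distinctTuples {X : Type*} [MeasurableSpace X] [MeasurableEq X] (k : ℕ) :
    MeasurableSet (distinctTuples X k) := by
  have : distinctTuples X k = ⋂ i, ⋂ j, ⋂ _ : i ≠ j, {x : Fin k → X | x i = x j}ᶜ := by
    ext; simp [distinctTuples]
  rw [this]
  exact .iInter fun i => .iInter fun j => .iInter fun _ =>
    (measurableSet_eq_fun (measurable_pi_apply i) (measurable_pi_apply j)).compl

lemma measurable_process_pair {X : Type*} [TopologicalSpace X] [MeasurableSpace X]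
    {f : (Fin 2 → X) → Configuration X → ℝ} (hf : IsProcess f) {k : ℕ} (a b c d : Fin k) :
    Measurable (Function.uncurry fun (ω : Configuration X) (v : Fin k → X) =>
      ENNReal.ofReal (f ![v a, v b] ω * f ![v c, v d] ω)) := by
  have h (a b : Fin k) : Measurable fun p : Configuration X × (Fin k → X) =>
      f ![p.2 a, p.2 b] p.1 := by
    refine Measurable.comp (g := fun p : (Fin 2 → X) × Configuration X => f p.1 p.2) hf
      (Measurable.prodMk (measurable_pi_lambda _ fun i => ?_) measurable_fst)
    fin_cases i
    · exact (measurable_pi_apply a).comp measurable_snd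
    · exact (measurable_pi_apply b).comp measurable_snd
  exact ((h a b).mul (h c d)).ennreal_ofReal

lemma pairSum_ofReal {X : Type*} [TopologicalSpace X]
    {f : (Fin 2 → X) → Configuration X → ℝ} (hf0 : ∀ x ω, 0 ≤ f x ω) {k : ℕ}
    (a b c d : Fin k) (ω : Configuration X) :
    ω.pairSum (fun x y => ENNReal.ofReal (f ![x, y] ω)) a b c d =
      ω.factorialSum fun v => ENNReal.ofReal (f ![v a, v b] ω * f ![v c, v d] ω) := by
  simp only [pairSum, ENNReal.ofReal_mul (hf0 _ _)]

variable {X : Type*} [TopologicalSpace X] [T2Space X] [SecondCountableTopology X]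
  [SigmaCompactSpace X] [MeasurableSpace X] [BorelSpace X]
  {P : Measure (Configuration X)} {σ : Measure X}

lemma measurable_pairSum {f : (Fin 2 → X) → Configuration X → ℝ} (hf : IsProcess f)
    (hf0 : ∀ x ω, 0 ≤ f x ω) {k : ℕ} (a b c d : Fin k) :
    Measurable fun ω : Configuration X =>
      ω.pairSum (fun x y => ENNReal.ofReal (f ![x, y] ω)) a b c d := by
  simp_rw [pairSum_ofReal hf0]
  exact measurable_factorialSum measurable_id (measurable_process_pair hf a b c d)

/-- The multivariate Mecke formula for pair sums; the integral may be restricted to pairwise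
different points because the factorial sum only sees those. -/
lemma lintegral_pairSum [SigmaFinite σ] [NullSingletonClass σ] (hP : IsPoissonMeasure P σ)
    {f : (Fin 2 → X) → Configuration X → ℝ} (hf : IsProcess f) (hf0 : ∀ x ω, 0 ≤ f x ω) {k : ℕ}
    (a b c d : Fin k) :
    ∫⁻ ω, ω.pairSum (fun x y => ENNReal.ofReal (f ![x, y] ω)) a b c d ∂P =
      ∫⁻ x in distinctTuples X k, (∫⁻ ω, ENNReal.ofReal
        (f ![x a, x b] (ω.addPoints x) * f ![x c, x d] (ω.addPoints x)) ∂P)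
        ∂(Measure.pi fun _ : Fin k => σ) := by
  have hD := measurableSet_distinctTuples (X := X) k
  let g (ω : Configuration X) (v : Fin k → X) : ℝ≥0∞ := (distinctTuples X k).indicator
    (fun v => ENNReal.ofReal (f ![v a, v b] ω * f ![v c, v d] ω)) v
  have hg : Measurable (Function.uncurry g) := by
    have : Function.uncurry g = (Prod.snd ⁻¹' distinctTuples X k).indicator
        (Function.uncurry fun (ω : Configuration X) (v : Fin k → X) =>
          ENNReal.ofReal (f ![v a, v b] ω * f ![v c, v d] ω)) := rfl
    rw [this]
    exact (measurable_process_pair hf a b c d).indicator (measurable_snd hD)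
  have h1 (ω : Configuration X) :
      ω.pairSum (fun x y => ENNReal.ofReal (f ![x, y] ω)) a b c d = ω.factorialSum (g ω) := by
    rw [pairSum_ofReal hf0]
    refine ω.factorialSum_congr fun v hv => ?_
    have hvD : v ∈ distinctTuples X k := fun i j hij => hv.ne hij
    simp [g, hvD]
  simp_rw [h1]
  rw [hP.lintegral_factorialSum hg, ← lintegral_indicator hD]
  refine lintegral_congr fun x => ?_
  by_cases hx : x ∈ distinctTuples X k <;> simp [g, hx]

lemma lintegral_pairSum_one [SigmaFinite σ] [NullSingletonClass σ] (hP : IsPoissonMeasure P σ)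
    {f : (Fin 2 → X) → Configuration X → ℝ} (hf : IsProcess f) (hf0 : ∀ x ω, 0 ≤ f x ω) :
    ∫⁻ ω, ω.pairSum (k := 1) (fun x y => ENNReal.ofReal (f ![x, y] ω)) 0 0 0 0 ∂P =
      ∫⁻ x, (∫⁻ ω, ENNReal.ofReal (f ![x, x] (ω.addPoints ![x]) ^ 2) ∂P) ∂σ := by
  have := hP.isProbabilityMeasure
  have h1 : distinctTuples X 1 = Set.univ :=
    Set.eq_univ_of_forall fun v i j hij => absurd (Subsingleton.elim i j) hij
  have hpres : MeasurePreserving (MeasurableEquiv.funUnique (Fin 1) X).symm σ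
      (Measure.pi fun _ : Fin 1 => σ) := by
    -- The two sides carry different `Fintype` instances on `Fin 1`.
    convert (measurePreserving_funUnique σ (Fin 1)).symm
  rw [hP.lintegral_pairSum hf hf0, h1, Measure.restrict_univ,
    ← hpres.lintegral_comp_emb (MeasurableEquiv.measurableEmbedding _)]
  refine lintegral_congr fun x => lintegral_congr fun ω => ?_
  have hx : (MeasurableEquiv.funUnique (Fin 1) X).symm x = ![x] := by
    ext i
    fin_cases i
    rfl
  rw [hx, sq]
  rfl

end IsPoissonMeasure

theorem mainTheorem6 {X : Type*} [MetricSpace X] [LocallyCompactSpace X]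
    [TopologicalSpace.SeparableSpace X] [MeasurableSpace X] [BorelSpace X]
    (σ : Measure X) [SigmaFinite σ] [NullSingletonClass σ]
    (P : Measure (Configuration X)) (hP : IsPoissonMeasure P σ)
    (f : (Fin 2 → X) → Configuration X → ℝ) (hf : IsProcess f) (hf0 : ∀ x ω, 0 ≤ f x ω) :
    ∫⁻ ω, (∫⁻ x₂, ∫⁻ x₁, ENNReal.ofReal (f ![x₁, x₂] ω) ∂ω.toMeasure ∂ω.toMeasure) ^ 2 ∂P
    = (∫⁻ x, (∫⁻ ω, ENNReal.ofReal (f ![x, x] (ω.addPoints ![x]) ^ 2) ∂P) ∂σ)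
      + 2 * (∫⁻ x in distinctTuples X 2, (∫⁻ ω, ENNReal.ofReal
          (f ![x 0, x 0] (ω.addPoints x) * f ![x 0, x 1] (ω.addPoints x)) ∂P)
          ∂(Measure.pi fun _ : Fin 2 => σ))
      + 2 * (∫⁻ x in distinctTuples X 2, (∫⁻ ω, ENNReal.ofReal
          (f ![x 0, x 0] (ω.addPoints x) * f ![x 1, x 0] (ω.addPoints x)) ∂P)
          ∂(Measure.pi fun _ : Fin 2 => σ))
      + (∫⁻ x in distinctTuples X 2, (∫⁻ ω, ENNReal.ofReal
          (f ![x 0, x 0] (ω.addPoints x) * f ![x 1, x 1] (ω.addPoints x)) ∂P)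
          ∂(Measure.pi fun _ : Fin 2 => σ))
      + (∫⁻ x in distinctTuples X 2, (∫⁻ ω, ENNReal.ofReal
          (f ![x 0, x 1] (ω.addPoints x) ^ 2) ∂P)
          ∂(Measure.pi fun _ : Fin 2 => σ))
      + (∫⁻ x in distinctTuples X 2, (∫⁻ ω, ENNReal.ofReal
          (f ![x 0, x 1] (ω.addPoints x) * f ![x 1, x 0] (ω.addPoints x)) ∂P)
          ∂(Measure.pi fun _ : Fin 2 => σ))
      + 2 * (∫⁻ x in distinctTuples X 3, (∫⁻ ω, ENNReal.ofReal
          (f ![x 0, x 0] (ω.addPoints x) * f ![x 1, x 2] (ω.addPoints x)) ∂P)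
          ∂(Measure.pi fun _ : Fin 3 => σ))
      + 2 * (∫⁻ x in distinctTuples X 3, (∫⁻ ω, ENNReal.ofReal
          (f ![x 0, x 1] (ω.addPoints x) * f ![x 2, x 0] (ω.addPoints x)) ∂P)
          ∂(Measure.pi fun _ : Fin 3 => σ))
      + (∫⁻ x in distinctTuples X 3, (∫⁻ ω, ENNReal.ofReal
          (f ![x 0, x 1] (ω.addPoints x) * f ![x 0, x 2] (ω.addPoints x)) ∂P)
          ∂(Measure.pi fun _ : Fin 3 => σ))
      + (∫⁻ x in distinctTuples X 3, (∫⁻ ω, ENNReal.ofReal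
          (f ![x 1, x 0] (ω.addPoints x) * f ![x 2, x 0] (ω.addPoints x)) ∂P)
          ∂(Measure.pi fun _ : Fin 3 => σ))
      + (∫⁻ x in distinctTuples X 4, (∫⁻ ω, ENNReal.ofReal
          (f ![x 0, x 1] (ω.addPoints x) * f ![x 2, x 3] (ω.addPoints x)) ∂P)
          ∂(Measure.pi fun _ : Fin 4 => σ)) := by
  have : SecondCountableTopology X := UniformSpace.secondCountable_of_separable X
  have hm {k : ℕ} (a b c d : Fin k) := IsPoissonMeasure.measurable_pairSum hf hf0 a b c d
  simp_rw [Configuration.sq_lintegral_lintegral_toMeasure,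
    fun (x : Fin 2 → X) (ω : Configuration X) => sq (f ![x 0, x 1] (ω.addPoints x))]
  rw [← hP.lintegral_pairSum_one hf hf0]
  simp_rw [← hP.lintegral_pairSum hf hf0]
  repeat first
    | rw [lintegral_add_right _ (hm _ _ _ _)]
    | rw [lintegral_add_right _ ((hm _ _ _ _).const_mul 2)]
  repeat rw [lintegral_const_mul _ (hm _ _ _ _)]
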